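/- Let $\mathfrak{S}_\infty$ be the group of bijections of $\mathbb{N}$ that move only finitely many points, let $\Gamma=\mathbb{Z}_2$, let $\Gamma_e^\infty$ be the group of sequences in $\Gamma$ with only finitely many nontrivial entries, and let $G=\Gamma\wr\mathfrak{S}_\infty=\Gamma_e^\infty\rtimes\mathfrak{S}_\infty$, where $s\gamma=(\gamma_{s^{-1}(i)})_i\,s$ for $s\in\mathfrak{S}_\infty$, $\gamma=(\gamma_i)_i\in\Gamma_e^\infty$. Let $(p_{ij})_{i,j\in\{0,1\}}$ be strictly positive real numbers with $\sum_{i,j}p_{ij}=1$, let $\nu$ be the probability measure on $\mathbb{Z}_2\times\mathbb{Z}_2$ with $\nu(\{(k,l)\})=p_{kl}$, and let $(X,\mu)=\prod_{i\in\mathbb{N}}(\mathbb{Z}_2\times\mathbb{Z}_2,\nu)$; write $x=(x_i)_i\in X$ with $x_i=(x_i^{(0)},x_i^{(1)})$. For $s=(s_0,s_1)\in\mathfrak{S}_\infty\times\mathfrak{S}_\infty$ define $\mathfrak{a}_s:X\to X$ by $(\mathfrak{a}_s x)_i^{(k)}=x_{s_k(i)}^{(k)}$ $(k=0,1)$; since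 all $p_{ij}$ are nonzero, $\mu$ is quasi-invariant under these maps. Let $\pi_\mu$ be the unitary representation of $G\times G$ in the complex Hilbert space $L^2(X,\mu)$ such that, for $s=(s_0,s_1)\in\mathfrak{S}_\infty\times\mathfrak{S}_\infty$ and $\gamma=(\gamma^{(0)},\gamma^{(1)})\in\Gamma_e^\infty\times\Gamma_e^\infty$, $$(\pi_\mu(s)\varsigma)(x)=\left(\frac{d\mu(\mathfrak{a}_s(x))}{d\mu(x)}\right)^{1/2}\varsigma(\mathfrak{a}_s(x)),\qquad (\pi_\mu(\gamma)\varsigma)(x)=(-1)^{\sum_{i,k}\gamma_i^{(k)}x_i^{(k)}}\varsigma(x).$$ Put $\pi_\mu^{(0)}(g)=\pi_\mu((g,e_G))$ and $\pi_\mu^{(1)}(g)=\pi_\mu((e_G,g))$ for $g\in G$, let $\pi_\mu^{(j)}(G)''$ be the bicommutant of $\pi_\mu^{(j)}(G)$ in the algebra of bounded operators on $L^2(X,\mu)$, and let $\mathbb{I}\in L^2(X,\mu)$ be the function identically equal to $1$. If $\det[p_{ij}]\neq0$, then $\mathbb{I}$ is cyclic and separating both for $\pi_\mu^{(0)}(G)''$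 and for $\pi_\mu^{(1)}(G)''$. That is, for $j=0,1$ the closed linear span of $\{A\mathbb{I} : A\in\pi_\mu^{(j)}(G)''\}$ is $L^2(X,\mu)$, and every $A\in\pi_\mu^{(j)}(G)''$ with $A\mathbb{I}=0$ is $0$. -/

import Mathlib

open MeasureTheory
open scoped ENNReal

noncomputable section

namespace WreathRep

/-! ### Weighted composition operators on `L²` -/

section WeightedComposition

/-- The Radon-Nikodym derivative `dμ(T x) / dμ(x)`, i.e. the density with respect to `μ` of the
measure `E ↦ μ (T E)`, which is the image of `μ` under `T⁻¹`. -/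
def jac {Ω : Type*} [MeasurableSpace Ω] (μ : Measure Ω) (T : Ω ≃ᵐ Ω) : Ω → ℝ≥0∞ :=
  (μ.map T.symm).rnDeriv μ

/-- The function `x ↦ c x * (dμ(T x) / dμ(x)) ^ (1/2)`. -/
def weight {Ω : Type*} [MeasurableSpace Ω] (μ : Measure Ω) (T : Ω ≃ᵐ Ω) (c : Ω → ℂ) (x : Ω) : ℂ :=
  c x * ((Real.sqrt (jac μ T x).toReal : ℝ) : ℂ)

variable {Ω : Type*} [MeasurableSpace Ω] {μ : Measure Ω}

/-- A nonsingular automorphism `T` (one for which `μ` is quasi-invariant) together with a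
measurable unimodular function `c`. -/
structure WeightedAut (μ : Measure Ω) where
  T : Ω ≃ᵐ Ω
  c : Ω → ℂ
  qmp : Measure.QuasiMeasurePreserving T μ μ
  qmp_symm : Measure.QuasiMeasurePreserving T.symm μ μ
  meas : Measurable c
  norm_c : ∀ x, ‖c x‖ = 1

theorem measurable_weight (W : WeightedAut μ) : Measurable (weight μ W.T W.c) := by
  have h : Measurable (jac μ W.T) := Measure.measurable_rnDeriv _ _
  have := W.meas
  unfold weight
  fun_prop

variable [IsFiniteMeasure μ]

theorem jac_comp (S T : Ω ≃ᵐ Ω) (hS : Measure.QuasiMeasurePreserving S.symm μ μ)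
    (hT : Measure.QuasiMeasurePreserving T.symm μ μ) :
    jac μ (S.trans T) =ᵐ[μ] fun x => jac μ S x * jac μ T (S x) := by
  have hm : Measurable fun x => jac μ T (S x) :=
    (Measure.measurable_rnDeriv _ _).comp S.measurable
  have key : μ.map (S.trans T).symm = μ.withDensity (jac μ S * fun x => jac μ T (S x)) := by
    rw [withDensity_mul (f := jac μ S) _ (Measure.measurable_rnDeriv _ _) hm]
    have h1 : μ.withDensity (jac μ S) = μ.map S.symm :=
      Measure.withDensity_rnDeriv_eq _ _ hS.absolutelyContinuous
    have h2 : μ.withDensity (jac μ T) = μ.map T.symm :=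
      Measure.withDensity_rnDeriv_eq _ _ hT.absolutelyContinuous
    have h3 : μ.map (S.trans T).symm = (μ.map T.symm).map S.symm := by
      rw [Measure.map_map S.symm.measurable T.symm.measurable]; rfl
    rw [h1, h3, ← h2]
    ext s hs
    rw [S.symm.map_apply, withDensity_apply _ (S.symm.measurable hs), withDensity_apply _ hs,
      S.symm.restrict_map, lintegral_map_equiv _ S.symm]
    simp
  unfold jac at key ⊢
  rw [key]
  exact Measure.rnDeriv_withDensity _
    ((Measure.measurable_rnDeriv _ _).mul hm)

theorem eLpNorm_weight_mul (W : WeightedAut μ) {f : Ω → ℂ} (hf : AEStronglyMeasurable f μ) :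
    eLpNorm (fun x => weight μ W.T W.c x * f (W.T x)) 2 μ = eLpNorm f 2 μ := by
  have hlt : ∀ᵐ x ∂μ, jac μ W.T x < ∞ := Measure.rnDeriv_lt_top _ _
  rw [eLpNorm_eq_lintegral_rpow_enorm_toReal (by norm_num) (by norm_num),
    eLpNorm_eq_lintegral_rpow_enorm_toReal (by norm_num) (by norm_num)]
  congr 1
  have h1 : ∫⁻ x, ‖weight μ W.T W.c x * f (W.T x)‖ₑ ^ (2 : ℝ≥0∞).toReal ∂μ
      = ∫⁻ x, jac μ W.T x * ‖f (W.T x)‖ₑ ^ (2 : ℝ≥0∞).toReal ∂μ := by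
    refine lintegral_congr_ae ?_
    filter_upwards [hlt] with x hx
    have hc : ‖W.c x‖ₑ = 1 := by rw [← ofReal_norm, W.norm_c]; simp
    have hs : ‖((Real.sqrt (jac μ W.T x).toReal : ℝ) : ℂ)‖ₑ ^ 2 = jac μ W.T x := by
      rw [← ofReal_norm, Complex.norm_real, Real.norm_of_nonneg (Real.sqrt_nonneg _),
        ← ENNReal.ofReal_pow (Real.sqrt_nonneg _), Real.sq_sqrt ENNReal.toReal_nonneg,
        ENNReal.ofReal_toReal hx.ne]
    simp only [weight, ENNReal.toReal_ofNat, ENNReal.rpow_ofNat, enorm_mul, mul_pow, hc, hs,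
      one_mul]
  have hf' : AEStronglyMeasurable (fun x => f (W.T x)) μ := hf.comp_quasiMeasurePreserving W.qmp
  rw [h1]
  unfold jac
  rw [lintegral_rnDeriv_mul W.qmp_symm.absolutelyContinuous
    (hf'.enorm.pow_const _), lintegral_map_equiv _ W.T.symm]
  simp

theorem memLp_weight_mul (W : WeightedAut μ) (f : Lp ℂ 2 μ) :
    MemLp (fun x => weight μ W.T W.c x * f (W.T x)) 2 μ := by
  refine ⟨(measurable_weight W).aestronglyMeasurable.mul
    ((Lp.aestronglyMeasurable f).comp_quasiMeasurePreserving W.qmp), ?_⟩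
  rw [eLpNorm_weight_mul W (Lp.aestronglyMeasurable f)]
  exact Lp.eLpNorm_lt_top f

/-- The isometry `(W f) x = c x * (dμ(T x) / dμ(x)) ^ (1/2) * f (T x)` of `L²(μ)`. -/
def weightedComp (W : WeightedAut μ) : Lp ℂ 2 μ →ₗᵢ[ℂ] Lp ℂ 2 μ where
  toFun f := (memLp_weight_mul W f).toLp _
  map_add' f g := by
    apply Lp.ext
    filter_upwards [MemLp.coeFn_toLp (memLp_weight_mul W (f + g)),
      Lp.coeFn_add ((memLp_weight_mul W f).toLp _) ((memLp_weight_mul W g).toLp _),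
      MemLp.coeFn_toLp (memLp_weight_mul W f), MemLp.coeFn_toLp (memLp_weight_mul W g),
      W.qmp.ae (Lp.coeFn_add f g)] with x h1 h2 h3 h4 h5
    rw [h1, h2, Pi.add_apply, h3, h4, h5, Pi.add_apply, mul_add]
  map_smul' a f := by
    apply Lp.ext
    filter_upwards [MemLp.coeFn_toLp (memLp_weight_mul W (a • f)),
      Lp.coeFn_smul a ((memLp_weight_mul W f).toLp _),
      MemLp.coeFn_toLp (memLp_weight_mul W f),
      W.qmp.ae (Lp.coeFn_smul a f)] with x h1 h2 h3 h5
    rw [h1, RingHom.id_apply, h2, Pi.smul_apply, h3, h5, Pi.smul_apply, smul_eq_mul, smul_eq_mul,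
      mul_left_comm]
  norm_map' f := by
    change ‖(memLp_weight_mul W f).toLp _‖ = ‖f‖
    rw [Lp.norm_toLp, eLpNorm_weight_mul W (Lp.aestronglyMeasurable f), Lp.norm_def]

theorem weightedComp_ae (W : WeightedAut μ) (f : Lp ℂ 2 μ) :
    weightedComp W f =ᵐ[μ] fun x => weight μ W.T W.c x * f (W.T x) :=
  MemLp.coeFn_toLp (memLp_weight_mul W f)

theorem weightedComp_comp (V W U : WeightedAut μ) (hT : ∀ x, U.T x = W.T (V.T x))
    (hc : ∀ x, U.c x = V.c x * W.c (V.T x)) (f : Lp ℂ 2 μ) :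
    weightedComp U f = weightedComp V (weightedComp W f) := by
  have hUT : U.T = V.T.trans W.T := by ext x; simp [hT]
  apply Lp.ext
  filter_upwards [weightedComp_ae U f, weightedComp_ae V (weightedComp W f),
    V.qmp.ae (weightedComp_ae W f), jac_comp V.T W.T V.qmp_symm W.qmp_symm] with x h1 h2 h3 h4
  rw [h1, h2, h3]
  simp only [weight, hc, hUT, h4, ENNReal.toReal_mul, Real.sqrt_mul ENNReal.toReal_nonneg]
  simp only [MeasurableEquiv.trans_apply]
  push_cast
  ring

theorem weightedComp_one (W : WeightedAut μ) (hT : ∀ x, W.T x = x) (hc : ∀ x, W.c x = 1)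
    (f : Lp ℂ 2 μ) : weightedComp W f = f := by
  have hinj := (weightedComp W).injective
  apply hinj
  rw [← weightedComp_comp W W W (by simp [hT]) (by simp [hc])]

end WeightedComposition

/-! ### The infinite symmetric group and wreath products with it -/

/-- `𝔖_∞`: the bijections of `ℕ` moving only finitely many points. -/
def FinPerm : Subgroup (Equiv.Perm ℕ) where
  carrier := {s | {i | s i ≠ i}.Finite}
  one_mem' := by simp
  mul_mem' {s t} hs ht := (hs.union ht).subset fun i hi => by
    by_contra h
    simp only [Set.mem_union, Set.mem_ofPred_eq, not_or, not_not] at h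
    exact hi (by rw [Equiv.Perm.mul_apply, h.2, h.1])
  inv_mem' {s} hs := hs.subset fun i hi h => hi (by
    rw [Equiv.Perm.inv_eq_iff_eq]; exact h.symm)

/-- `Γ_e^∞`: the sequences in `Γ` with finitely many entries different from the unit. -/
def FinSeq (Γ : Type*) [Group Γ] : Subgroup (ℕ → Γ) where
  carrier := {γ | {i | γ i ≠ 1}.Finite}
  one_mem' := by simp
  mul_mem' {γ δ} hγ hδ := (hγ.union hδ).subset fun i hi => by
    by_contra h
    simp only [Set.mem_union, Set.mem_ofPred_eq, not_or, not_not] at h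
    exact hi (by rw [Pi.mul_apply, h.1, h.2, one_mul])
  inv_mem' {γ} hγ := hγ.subset fun i hi h => hi (by rw [Pi.inv_apply, h, inv_one])

/-- The action of `𝔖_∞` on `Γ_e^∞`: `(s γ)_i = γ_{s⁻¹ i}`. -/
def permAction (Γ : Type*) [Group Γ] : FinPerm →* MulAut (FinSeq Γ) where
  toFun s :=
    { toFun := fun γ => ⟨fun i => γ.1 (s.1⁻¹ i),
        (γ.2.image s.1).subset fun i hi => ⟨s.1⁻¹ i, hi, by simp⟩⟩
      invFun := fun γ => ⟨fun i => γ.1 (s.1 i),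
        (γ.2.image (s.1⁻¹ : Equiv.Perm ℕ)).subset fun i hi => ⟨s.1 i, hi, by simp⟩⟩
      left_inv := fun γ => by ext i; simp
      right_inv := fun γ => by ext i; simp
      map_mul' := fun γ δ => rfl }
  map_one' := rfl
  map_mul' s t := by ext γ i; simp

/-- The wreath product `Γ ≀ 𝔖_∞ = Γ_e^∞ ⋊ 𝔖_∞`; the pair with components `left = γ` and
`right = s` is the product `γ · s`. -/
abbrev Wreath (Γ : Type*) [Group Γ] : Type _ := FinSeq Γ ⋊[permAction Γ] FinPerm

/-- `ℤ₂`, written multiplicatively. -/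
abbrev Z2 : Type := Multiplicative (ZMod 2)

/-- `G = ℤ₂ ≀ 𝔖_∞`. -/
abbrev G : Type := Wreath Z2

/-! ### The measure space -/

/-- `X = ∏ᵢ ℤ₂ × ℤ₂`. -/
abbrev X : Type := ℕ → ZMod 2 × ZMod 2

/-- Strictly positive weights `p i j` on `ℤ₂ × ℤ₂` with total mass one. -/
structure Weights where
  p : Matrix (ZMod 2) (ZMod 2) ℝ
  pos : ∀ i j, 0 < p i j
  sum_eq_one : ∑ i, ∑ j, p i j = 1

/-- The measure on `ℤ₂ × ℤ₂` giving mass `p k l` to the point `(k, l)`. -/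
def nu (P : Weights) : Measure (ZMod 2 × ZMod 2) :=
  ∑ z : ZMod 2 × ZMod 2, ENNReal.ofReal (P.p z.1 z.2) • Measure.dirac z

theorem nu_singleton (P : Weights) (z : ZMod 2 × ZMod 2) :
    nu P {z} = ENNReal.ofReal (P.p z.1 z.2) := by
  simp [nu, Measure.finsetSum_apply, Set.indicator_apply]

instance (P : Weights) : IsProbabilityMeasure (nu P) where
  measure_univ := by
    simp only [nu, Measure.finsetSum_apply, Measure.smul_apply, measure_univ, smul_eq_mul, mul_one]
    rw [← ENNReal.ofReal_sum_of_nonneg fun z _ => (P.pos z.1 z.2).le, Fintype.sum_prod_type,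
      P.sum_eq_one, ENNReal.ofReal_one]

/-- The product measure `μ = ∏ᵢ ν` on `X`. -/
def mu (P : Weights) : Measure X := Measure.infinitePi fun _ => nu P

instance (P : Weights) : IsProbabilityMeasure (mu P) := by
  unfold mu; infer_instance

/-- The action of `𝔖_∞ × 𝔖_∞` on `X`: `(𝔞_{(s₀,s₁)} x)_i^{(k)} = x_{s_k i}^{(k)}`. -/
def act (s₀ s₁ : FinPerm) : X ≃ᵐ X where
  toFun x i := ((x (s₀.1 i)).1, (x (s₁.1 i)).2)
  invFun x i := ((x (s₀.1⁻¹ i)).1, (x (s₁.1⁻¹ i)).2)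
  left_inv x := by ext i <;> simp
  right_inv x := by ext i <;> simp
  measurable_toFun := by
    simp only [Equiv.coe_fn_mk]; fun_prop
  measurable_invFun := by
    simp only [Equiv.coe_fn_symm_mk]; fun_prop

theorem act_symm (s₀ s₁ : FinPerm) : (act s₀ s₁).symm = act s₀⁻¹ s₁⁻¹ := by
  ext x i <;> rfl

theorem mu_split (P : Weights) (F : Finset ℕ) :
    MeasurePreserving (MeasurableEquiv.piEquivPiSubtypeProd (fun _ => ZMod 2 × ZMod 2) (· ∈ F))
      (mu P) ((Measure.infinitePi fun _ : {i // i ∈ F} => nu P).prod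
        (Measure.infinitePi fun _ : {i // i ∉ F} => nu P)) := by
  set e := MeasurableEquiv.piEquivPiSubtypeProd (fun _ : ℕ => ZMod 2 × ZMod 2) (· ∈ F)
  refine (MeasurePreserving.symm e.symm ⟨e.symm.measurable, ?_⟩)
  refine Measure.eq_infinitePi _ fun s t ht => ?_
  rw [e.symm.map_apply]
  have hset : e.symm ⁻¹' Set.pi s t =
      (Set.pi (s.subtype (· ∈ F) : Set {i // i ∈ F}) fun i => t i) ×ˢ
        (Set.pi (s.subtype (· ∉ F) : Set {i // i ∉ F}) fun i => t i) := by
    ext y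
    simp only [Set.mem_preimage, Set.mem_pi, Set.mem_prod, Finset.mem_coe, Finset.mem_subtype,
      Subtype.forall, e]
    constructor
    · intro h
      refine ⟨fun i hi his => ?_, fun i hi his => ?_⟩
      · simpa [MeasurableEquiv.piEquivPiSubtypeProd, hi] using h i his
      · simpa [MeasurableEquiv.piEquivPiSubtypeProd, hi] using h i his
    · rintro ⟨h1, h2⟩ i his
      by_cases hi : i ∈ F
      · simpa [MeasurableEquiv.piEquivPiSubtypeProd, hi] using h1 i hi his
      · simpa [MeasurableEquiv.piEquivPiSubtypeProd, hi] using h2 i hi his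
  rw [hset, Measure.prod_prod,
    Measure.infinitePi_pi (fun _ : {i // i ∈ F} => nu P) (t := fun i => t i) fun i _ => ht i,
    Measure.infinitePi_pi (fun _ : {i // i ∉ F} => nu P) (t := fun i => t i) fun i _ => ht i,
    Finset.prod_subtype_eq_prod_filter (f := fun i => nu P (t i)),
    Finset.prod_subtype_eq_prod_filter (f := fun i => nu P (t i)),
    Finset.prod_filter_mul_prod_filter_not]

/-- `μ` is quasi-invariant under `𝔖_∞ × 𝔖_∞`. -/
theorem act_qmp (P : Weights) (s₀ s₁ : FinPerm) :
    Measure.QuasiMeasurePreserving (act s₀ s₁) (mu P) (mu P) := by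
  classical
  let F : Finset ℕ := s₀.2.toFinset ∪ s₁.2.toFinset
  have h0 : ∀ i ∉ F, s₀.1 i = i := fun i hi => by
    by_contra h; exact hi (Finset.mem_union_left _ ((Set.Finite.mem_toFinset _).mpr h))
  have h1 : ∀ i ∉ F, s₁.1 i = i := fun i hi => by
    by_contra h; exact hi (Finset.mem_union_right _ ((Set.Finite.mem_toFinset _).mpr h))
  have h0' : ∀ i ∈ F, s₀.1 i ∈ F := fun i hi => by
    by_contra h; exact h (by rwa [← s₀.1.injective (h0 _ h)] at hi)
  have h1' : ∀ i ∈ F, s₁.1 i ∈ F := fun i hi => by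
    by_contra h; exact h (by rwa [← s₁.1.injective (h1 _ h)] at hi)
  let e := MeasurableEquiv.piEquivPiSubtypeProd (fun _ : ℕ => ZMod 2 × ZMod 2) (· ∈ F)
  have he := mu_split P F
  let b : ({i // i ∈ F} → ZMod 2 × ZMod 2) → ({i // i ∈ F} → ZMod 2 × ZMod 2) := fun y i =>
    ((y ⟨s₀.1 i, h0' i i.2⟩).1, (y ⟨s₁.1 i, h1' i i.2⟩).2)
  have hb : Measurable b := by
    simp only [b]; fun_prop
  have hbac : (Measure.infinitePi fun _ : {i // i ∈ F} => nu P).map b ≪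
      Measure.infinitePi fun _ : {i // i ∈ F} => nu P := by
    refine Measure.AbsolutelyContinuous.mk fun A _ hA => ?_
    have : A = ∅ := by
      by_contra hne
      obtain ⟨y, hy⟩ := Set.nonempty_iff_ne_empty.mpr hne
      have h0 := measure_mono_null (Set.singleton_subset_iff.mpr hy) hA
      rw [Measure.infinitePi_singleton_of_fintype, Finset.prod_eq_zero_iff] at h0
      obtain ⟨i, _, hi⟩ := h0
      rw [nu_singleton, ENNReal.ofReal_eq_zero] at hi
      exact absurd (P.pos _ _) hi.not_gt
    simp [this]
  have hprod : Measure.QuasiMeasurePreserving (Prod.map b id)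
      ((Measure.infinitePi fun _ : {i // i ∈ F} => nu P).prod
        (Measure.infinitePi fun _ : {i // i ∉ F} => nu P))
      ((Measure.infinitePi fun _ : {i // i ∈ F} => nu P).prod
        (Measure.infinitePi fun _ : {i // i ∉ F} => nu P)) := by
    refine ⟨hb.prodMap measurable_id, ?_⟩
    rw [← Measure.map_prod_map _ _ hb measurable_id, Measure.map_id]
    exact hbac.prod Measure.AbsolutelyContinuous.rfl
  have hcomp : (act s₀ s₁ : X → X) = e.symm ∘ Prod.map b id ∘ e := by
    funext x
    apply e.injective
    simp only [Function.comp_apply, MeasurableEquiv.apply_symm_apply]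
    refine Prod.ext (funext fun i => rfl) (funext fun i => ?_)
    change ((x (s₀.1 i)).1, (x (s₁.1 i)).2) = x i
    rw [h0 i i.2, h1 i i.2]
  rw [hcomp]
  exact ((MeasurePreserving.symm e he).quasiMeasurePreserving.comp hprod).comp
    he.quasiMeasurePreserving

/-! ### The representation -/

/-- `(-1) ^ a` for `a ∈ ℤ₂`. -/
def sgn (a : ZMod 2) : ℂ := (-1) ^ a.val

theorem sgn_add (a b : ZMod 2) : sgn (a + b) = sgn a * sgn b := by
  unfold sgn
  rw [← pow_add, ZMod.val_add, ← neg_one_pow_eq_pow_mod_two]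

/-- `(-1) ^ (∑_{i,k} γ_i^{(k)} x_i^{(k)})`, the (finite) sum being taken in `ℤ₂`. -/
def gammaSign (γ₀ γ₁ : FinSeq Z2) (x : X) : ℂ :=
  sgn (∑ᶠ i, ((γ₀.1 i).toAdd * (x i).1 + (γ₁.1 i).toAdd * (x i).2))

theorem finite_support (γ₀ γ₁ : FinSeq Z2) (x : X) :
    (Function.support fun i => (γ₀.1 i).toAdd * (x i).1 + (γ₁.1 i).toAdd * (x i).2).Finite := by
  refine (γ₀.2.union γ₁.2).subset fun i hi => ?_
  by_contra h
  simp only [Set.mem_union, Set.mem_ofPred_eq, not_or, not_not] at h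
  exact hi (by simp [h.1, h.2])

theorem measurable_gammaSign (γ₀ γ₁ : FinSeq Z2) : Measurable (gammaSign γ₀ γ₁) := by
  classical
  have h : ∀ x : X, ∑ᶠ i, ((γ₀.1 i).toAdd * (x i).1 + (γ₁.1 i).toAdd * (x i).2) =
      ∑ i ∈ (γ₀.2.union γ₁.2).toFinset,
        ((γ₀.1 i).toAdd * (x i).1 + (γ₁.1 i).toAdd * (x i).2) := fun x => by
    refine finsum_eq_sum_of_support_subset _ fun i hi => ?_
    by_contra h
    simp only [Set.Finite.coe_toFinset, Set.mem_union, Set.mem_ofPred_eq, not_or, not_not] at h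
    exact hi (by simp [h.1, h.2])
  unfold gammaSign
  simp only [h]
  refine (measurable_of_countable sgn).comp (Finset.measurable_sum _ fun i _ => ?_)
  exact (measurable_of_countable fun z : ZMod 2 × ZMod 2 =>
    (γ₀.1 i).toAdd * z.1 + (γ₁.1 i).toAdd * z.2).comp (measurable_pi_apply i)

/-- The data defining the operator `π_μ(g)`, `g ∈ G × G`. -/
def gAut (P : Weights) (g : G × G) : WeightedAut (mu P) where
  T := act g.1.right g.2.right
  c := gammaSign g.1.left g.2.left
  qmp := act_qmp P _ _
  qmp_symm := by rw [act_symm]; exact act_qmp P _ _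
  meas := measurable_gammaSign _ _
  norm_c x := by simp [gammaSign, sgn]

theorem gammaSign_mul (g h : G × G) (x : X) :
    gammaSign (g * h).1.left (g * h).2.left x =
      gammaSign g.1.left g.2.left x *
        gammaSign h.1.left h.2.left (act g.1.right g.2.right x) := by
  have hre : ∀ (γ : FinSeq Z2) (s : FinPerm) (u : ℕ → ZMod 2),
      ∑ᶠ i, (((permAction Z2 s γ).1 i).toAdd * u i) = ∑ᶠ i, ((γ.1 i).toAdd * u (s.1 i)) := by
    intro γ s u
    rw [← finsum_comp_equiv s.1]
    simp [permAction]
  have hadd : ∀ (γ₀ γ₁ : FinSeq Z2) (y : X),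
      ∑ᶠ i, ((γ₀.1 i).toAdd * (y i).1 + (γ₁.1 i).toAdd * (y i).2) =
        ∑ᶠ i, ((γ₀.1 i).toAdd * (y i).1) + ∑ᶠ i, ((γ₁.1 i).toAdd * (y i).2) := by
    intro γ₀ γ₁ y
    refine finsum_add_distrib ?_ ?_
    · have h := finite_support γ₀ 1 y
      simp only [Subgroup.coe_one, Pi.one_apply, toAdd_one, zero_mul, add_zero] at h
      exact h
    · have h := finite_support 1 γ₁ y
      simp only [Subgroup.coe_one, Pi.one_apply, toAdd_one, zero_mul, zero_add] at h
      exact h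
  have hact : gammaSign h.1.left h.2.left (act g.1.right g.2.right x) =
      gammaSign (permAction Z2 g.1.right h.1.left) (permAction Z2 g.2.right h.2.left) x := by
    unfold gammaSign
    rw [hadd, hadd, hre _ _ fun i => (x i).1, hre _ _ fun i => (x i).2]
    rfl
  rw [hact]
  unfold gammaSign
  rw [← sgn_add, ← finsum_add_distrib (finite_support _ _ _) (finite_support _ _ _)]
  congr 1
  refine finsum_congr fun i => ?_
  simp only [Prod.fst_mul, Prod.snd_mul, SemidirectProduct.mul_left, Subgroup.coe_mul,
    Pi.mul_apply, toAdd_mul]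
  ring

/-- `L²(X, μ)`. -/
abbrev H (P : Weights) : Type := Lp ℂ 2 (mu P)

theorem op_mul (P : Weights) (g h : G × G) (f : H P) :
    weightedComp (gAut P (g * h)) f = weightedComp (gAut P g) (weightedComp (gAut P h) f) :=
  weightedComp_comp _ _ _ (fun _ => rfl) (gammaSign_mul g h) f

theorem op_one (P : Weights) (f : H P) : weightedComp (gAut P 1) f = f :=
  weightedComp_one _ (fun _ => rfl) (fun x => by simp [gAut, gammaSign, sgn]) f

/-- The unitary representation `π_μ` of `G × G` in `L²(X, μ)`: for
`g = ((γ⁽⁰⁾, γ⁽¹⁾) · (s₀, s₁))`,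
`(π_μ(g) f)(x) = (-1) ^ (∑ γ_i^{(k)} x_i^{(k)}) * (dμ(𝔞_s x) / dμ(x)) ^ (1/2) * f (𝔞_s x)`. -/
def piMu (P : Weights) : G × G →* unitary (H P →L[ℂ] H P) :=
  (Unitary.linearIsometryEquiv (𝕜 := ℂ) (H := H P)).symm.toMonoidHom.comp
    { toFun := fun g =>
        { toLinearEquiv := LinearEquiv.ofLinearMap (weightedComp (gAut P g)).toLinearMap
            (weightedComp (gAut P g⁻¹)).toLinearMap
            (LinearMap.ext fun f => by
              change weightedComp (gAut P g) (weightedComp (gAut P g⁻¹) f) = f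
              rw [← op_mul, mul_inv_cancel, op_one])
            (LinearMap.ext fun f => by
              change weightedComp (gAut P g⁻¹) (weightedComp (gAut P g) f) = f
              rw [← op_mul, inv_mul_cancel, op_one])
          norm_map' := (weightedComp (gAut P g)).norm_map }
      map_one' := LinearIsometryEquiv.ext fun f => op_one P f
      map_mul' := fun g h => LinearIsometryEquiv.ext fun f => op_mul P g h f }

theorem piMu_apply_ae (P : Weights) (g : G × G) (f : H P) :
    (piMu P g : H P →L[ℂ] H P) f =ᵐ[mu P] fun x =>
      gammaSign g.1.left g.2.left x *
        ((Real.sqrt (((mu P).map (act g.1.right g.2.right).symm).rnDeriv (mu P) x).toReal : ℝ) : ℂ) *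
        f (act g.1.right g.2.right x) :=
  weightedComp_ae (gAut P g) f

/-- `π_μ^{(0)}(g) = π_μ(g, e)`. -/
def piMu0 (P : Weights) : G →* unitary (H P →L[ℂ] H P) := (piMu P).comp (MonoidHom.inl G G)

/-- `π_μ^{(1)}(g) = π_μ(e, g)`. -/
def piMu1 (P : Weights) : G →* unitary (H P →L[ℂ] H P) := (piMu P).comp (MonoidHom.inr G G)

/-- The function identically equal to one, as an element of `L²(X, μ)`. -/
def constOne (P : Weights) : H P := Lp.const 2 (mu P) (1 : ℂ)

/-! ### Bicommutants, cyclic and separating vectors -/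

/-- `π(K)''`, the bicommutant of the image of a unitary representation. -/
def bicommutant {K E : Type*} [Group K] [NormedAddCommGroup E] [InnerProductSpace ℂ E]
    [CompleteSpace E] (π : K →* unitary (E →L[ℂ] E)) : Set (E →L[ℂ] E) :=
  (Set.range fun g => (π g : E →L[ℂ] E)).centralizer.centralizer

/-- `ξ` is cyclic for `M`: the closed linear span of `{a ξ | a ∈ M}` is the whole space. -/
def IsCyclicVector {E : Type*} [NormedAddCommGroup E] [InnerProductSpace ℂ E]
    (M : Set (E →L[ℂ] E)) (ξ : E) : Prop :=
  (Submodule.span ℂ ((fun a => a ξ) '' M)).topologicalClosure = ⊤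

/-- `ξ` is separating for `M`: an operator `a ∈ M` with `a ξ = 0` vanishes. -/
def IsSeparatingVector {E : Type*} [NormedAddCommGroup E] [InnerProductSpace ℂ E]
    (M : Set (E →L[ℂ] E)) (ξ : E) : Prop :=
  ∀ a ∈ M, a ξ = 0 → a = 0

end WreathRep

end

/-! Separation follows from cyclicity. The two copies of `G` commute, so an operator in one
bicommutant commutes with the whole other bicommutant. If it kills `𝕀`, it kills the orbit of `𝕀`
under the other algebra, which is dense (`isSeparatingVector_of_commute`).

For cyclicity, let `K` be the closed span of the orbit of `𝕀` under one copy, `c` the coordinate of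
`ℤ₂ × ℤ₂` on which that copy acts and `d` the other. The indicator `1_C` of every cylinder lies in
`K`, by induction on the length `k` of `C` (`eq_top_of_invariant`). The sign characters allow
multiplication by the indicator of any value of `c(x_i)`. Swapping the `c`-coordinates at `k` and `N
> k` multiplies `1_C` by the square root of the Jacobian. Where `c(x_k) = a` and `c(x_N) = a + 1`,
this root is a function `Q` of `d(x_k)` times a function of `d(x_N)`. As `N` varies, the latter
factors are independent and identically distributed, so averaging over `N` replaces them by their
mean, which is positive (`represents_of_forall_gt`). Hence `1_C 1_{c(x_k) = a} Q(d(x_k))` lies in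
`K`. The nonzero determinant says that `Q` separates the two values of `d`, so interpolation yields
the indicators of the cylinders of length `k + 1`. -/

namespace WreathRep

/-! ### Cylinder sets -/

/-- The sequences that agree with `z` in the first `n` places. -/
def cyl (n : ℕ) (z : X) : Set X := {x | ∀ i < n, x i = z i}

theorem cyl_eq_pi (n : ℕ) (z : X) :
    cyl n z = Set.pi (Finset.range n : Set ℕ) fun i => {z i} := by
  ext x; simp [cyl]

theorem measurableSet_cyl (n : ℕ) (z : X) : MeasurableSet (cyl n z) := by
  rw [cyl_eq_pi]
  exact MeasurableSet.pi (Finset.range n).countable_toSet fun i _ => measurableSet_singleton _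

theorem cyl_eq_of_mem {n : ℕ} {x z : X} (h : x ∈ cyl n z) : cyl n x = cyl n z := by
  ext y
  refine forall₂_congr fun i hi => ?_
  rw [h i hi]

theorem cyl_anti {m n : ℕ} (h : m ≤ n) (z : X) : cyl n z ⊆ cyl m z :=
  fun _ hx i hi => hx i (hi.trans_le h)

/-- Two cylinders that meet are nested, so their intersection is the longer one and the lower bound
on the length survives. The bound allows measures to be compared only on cylinders long enough to
contain the support of a permutation. -/
theorem isPiSystem_cyl (n : ℕ) : IsPiSystem {s | ∃ m ≥ n, ∃ z, s = cyl m z} := by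
  rintro _ ⟨k, hk, z, rfl⟩ _ ⟨l, hl, w, rfl⟩ ⟨x, hx, hy⟩
  rw [← cyl_eq_of_mem hx, ← cyl_eq_of_mem hy]
  rcases le_total k l with h | h
  · exact ⟨l, hl, x, Set.inter_eq_right.mpr (cyl_anti h x)⟩
  · exact ⟨k, hk, x, Set.inter_eq_left.mpr (cyl_anti h x)⟩

/-- Countably many cylinders of a given length cover `X`. -/
theorem exists_seq_cyl (n : ℕ) : ∃ z : ℕ → X, ⋃ j, cyl n (z j) = Set.univ := by
  obtain ⟨f, hf⟩ := exists_surjective_nat (Fin n → ZMod 2 × ZMod 2)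
  -- The value `0` from place `n` on is arbitrary: a cylinder of length `n` does not see it.
  refine ⟨fun j i => if h : i < n then f j ⟨i, h⟩ else 0, Set.eq_univ_of_forall fun x => ?_⟩
  obtain ⟨j, hj⟩ := hf fun i => x i
  refine Set.mem_iUnion.mpr ⟨j, fun i hi => ?_⟩
  simp [hi, hj]

theorem generateFrom_cyl (n : ℕ) :
    (inferInstance : MeasurableSpace X) =
      MeasurableSpace.generateFrom {s | ∃ m ≥ n, ∃ z, s = cyl m z} := by
  refine le_antisymm ?_ (MeasurableSpace.generateFrom_le ?_)
  · refine iSup_le fun i => ?_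
    refine Measurable.comap_le (@measurable_to_countable' _ _ (_) _
      (MeasurableSpace.generateFrom _) _ fun a => ?_)
    -- Length at least `n` puts the cylinders in the generating family; length above `i` makes
    -- coordinate `i` constant on each of them.
    obtain ⟨z, hz⟩ := exists_seq_cyl (max n (i + 1))
    have : (fun x : X => x i) ⁻¹' {a} = ⋃ j ∈ {j | z j i = a}, cyl (max n (i + 1)) (z j) := by
      ext x
      have hx : x ∈ ⋃ j, cyl (max n (i + 1)) (z j) := hz ▸ Set.mem_univ x
      simp only [Set.mem_iUnion] at hx
      obtain ⟨j, hj⟩ := hx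
      simp only [Set.mem_preimage, Set.mem_singleton_iff, Set.mem_iUnion, Set.mem_ofPred_eq,
        exists_prop]
      refine ⟨fun h => ⟨j, (hj i (by omega)).symm.trans h, hj⟩, ?_⟩
      rintro ⟨l, rfl, hl⟩
      exact hl i (by omega)
    rw [this]
    exact MeasurableSet.biUnion (Set.to_countable _) fun j _ =>
      MeasurableSpace.measurableSet_generateFrom ⟨_, le_max_left _ _, _, rfl⟩
  · rintro _ ⟨m, -, z, rfl⟩
    exact measurableSet_cyl m z

theorem ext_of_cyl {α β : Measure X} [IsFiniteMeasure α] (n : ℕ)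
    (h : ∀ m ≥ n, ∀ z, α (cyl m z) = β (cyl m z)) : α = β := by
  obtain ⟨z, hz⟩ := exists_seq_cyl n
  refine Measure.ext_of_generateFrom_of_iUnion _ (fun j => cyl n (z j)) (generateFrom_cyl n)
    (isPiSystem_cyl n) hz (fun j => ⟨n, le_rfl, z j, rfl⟩) (fun j => measure_ne_top _ _) ?_
  rintro _ ⟨m, hm, w, rfl⟩
  exact h m hm w

theorem mu_cyl (P : Weights) (n : ℕ) (z : X) :
    mu P (cyl n z) = ENNReal.ofReal (∏ i ∈ Finset.range n, P.p (z i).1 (z i).2) := by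
  rw [cyl_eq_pi, mu, Measure.infinitePi_pi _ fun i _ => measurableSet_singleton _,
    ENNReal.ofReal_prod_of_nonneg fun i _ => (P.pos _ _).le]
  simp only [nu_singleton]

/-- A function with vanishing integral over all cylinders vanishes almost everywhere. -/
theorem ae_eq_zero_of_forall_cyl {P : Weights} {h : X → ℂ} (hh : Integrable h (mu P))
    (H : ∀ n z, ∫ x in cyl n z, h x ∂mu P = 0) : h =ᵐ[mu P] 0 := by
  -- The cylinder of length zero is the whole space; complements need this total integral.
  have huniv : ∫ x, h x ∂mu P = 0 := by
    have := H 0 0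
    rwa [show cyl 0 0 = Set.univ from Set.eq_univ_of_forall fun x i hi => by omega,
      setIntegral_univ] at this
  refine Integrable.ae_eq_zero_of_forall_setIntegral_eq_zero hh fun s hs _ => ?_
  induction s, hs using MeasurableSpace.induction_on_inter (generateFrom_cyl 0)
    (isPiSystem_cyl 0) with
  | empty => simp
  | basic t ht => obtain ⟨n, -, z, rfl⟩ := ht; exact H n z
  | compl t ht ih =>
    have := integral_add_compl ht hh
    rwa [ih (measure_lt_top _ _), zero_add, huniv] at this
  | iUnion f hd hm ih =>
    rw [integral_iUnion hm hd hh.integrableOn]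
    simp [ih]

/-! ### The Radon-Nikodym derivative of the action -/

theorem lt_of_fixed_above {s : Equiv.Perm ℕ} {n : ℕ} (hs : ∀ i ≥ n, s i = i) {i : ℕ}
    (hi : i < n) : s i < n := by
  by_contra h
  have := s.injective (hs _ (not_lt.mp h))
  omega

theorem act_mem_cyl {s₀ s₁ : FinPerm} {n : ℕ} (h₀ : ∀ i ≥ n, s₀.1 i = i)
    (h₁ : ∀ i ≥ n, s₁.1 i = i) {x z : X} (hx : x ∈ cyl n z) :
    act s₀ s₁ x ∈ cyl n (act s₀ s₁ z) := fun i hi => by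
  change ((x (s₀.1 i)).1, (x (s₁.1 i)).2) = ((z (s₀.1 i)).1, (z (s₁.1 i)).2)
  rw [hx _ (lt_of_fixed_above h₀ hi), hx _ (lt_of_fixed_above h₁ hi)]

/-- Permutations fixing every place from `n` on permute the first `n` places among themselves, so
cylinders of length `n` go to cylinders of the same length. -/
theorem act_symm_preimage_cyl {s₀ s₁ : FinPerm} {n : ℕ} (h₀ : ∀ i ≥ n, s₀.1 i = i)
    (h₁ : ∀ i ≥ n, s₁.1 i = i) (z : X) :
    (act s₀ s₁).symm ⁻¹' cyl n z = cyl n (act s₀ s₁ z) := by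
  have h (s : FinPerm) (hs : ∀ i ≥ n, s.1 i = i) : ∀ i ≥ n, (s⁻¹).1 i = i := fun i hi => by
    rw [Subgroup.coe_inv, Equiv.Perm.inv_eq_iff_eq, hs i hi]
  ext x
  constructor
  · intro hx
    simpa using act_mem_cyl h₀ h₁ hx
  · intro hx
    have := act_mem_cyl (h s₀ h₀) (h s₁ h₁) hx
    rw [← act_symm, MeasurableEquiv.symm_apply_apply] at this
    exact this

/-- On cylinders of length at least `n` the proposed density is constant, and it is the ratio of the
masses of the moved and the original cylinder. Such cylinders determine the measure. -/
theorem jac_act (P : Weights) {s₀ s₁ : FinPerm} {n : ℕ} (h₀ : ∀ i ≥ n, s₀.1 i = i)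
    (h₁ : ∀ i ≥ n, s₁.1 i = i) :
    jac (mu P) (act s₀ s₁) =ᵐ[mu P] fun x => ENNReal.ofReal (∏ i ∈ Finset.range n,
      P.p (act s₀ s₁ x i).1 (act s₀ s₁ x i).2 / P.p (x i).1 (x i).2) := by
  set ρ : X → ℝ≥0∞ := fun x => ENNReal.ofReal (∏ i ∈ Finset.range n,
    P.p (act s₀ s₁ x i).1 (act s₀ s₁ x i).2 / P.p (x i).1 (x i).2) with hρ
  have hmeas : Measurable ρ := by
    refine ENNReal.measurable_ofReal.comp (Finset.measurable_fun_prod _ fun i _ => ?_)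
    have hp : Measurable fun z : ZMod 2 × ZMod 2 => P.p z.1 z.2 := measurable_of_countable _
    exact (hp.comp ((measurable_pi_apply i).comp (act s₀ s₁).measurable)).div
      (hp.comp (measurable_pi_apply i))
  have hpos (z : X) (i : ℕ) : 0 < P.p (z i).1 (z i).2 := P.pos _ _
  have key : (mu P).map (act s₀ s₁).symm = (mu P).withDensity ρ := by
    have : IsProbabilityMeasure ((mu P).map (act s₀ s₁).symm) :=
      Measure.isProbabilityMeasure_map (act s₀ s₁).symm.measurable.aemeasurable
    refine ext_of_cyl n fun m hm z => ?_
    have h₀' : ∀ i ≥ m, s₀.1 i = i := fun i hi => h₀ i (hm.trans hi)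
    have h₁' : ∀ i ≥ m, s₁.1 i = i := fun i hi => h₁ i (hm.trans hi)
    have hconst : ∀ x ∈ cyl m z, ρ x = ρ z := fun x hx => by
      simp only [hρ]
      congr 1
      refine Finset.prod_congr rfl fun i hi => ?_
      have him : i < m := (Finset.mem_range.mp hi).trans_le hm
      rw [hx i him, act_mem_cyl h₀' h₁' hx i him]
    rw [MeasurableEquiv.map_apply, act_symm_preimage_cyl h₀' h₁',
      withDensity_apply _ (measurableSet_cyl m z),
      setLIntegral_congr_fun (measurableSet_cyl m z) hconst, setLIntegral_const, mu_cyl, mu_cyl,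
      hρ, ← ENNReal.ofReal_mul (Finset.prod_nonneg fun i _ => (div_pos (hpos _ i) (hpos _ i)).le)]
    congr 1
    -- The action fixes the places from `n` to `m`, so the additional factors are `1`.
    have hext : ∏ i ∈ Finset.range n,
        P.p (act s₀ s₁ z i).1 (act s₀ s₁ z i).2 / P.p (z i).1 (z i).2 = ∏ i ∈ Finset.range m,
        P.p (act s₀ s₁ z i).1 (act s₀ s₁ z i).2 / P.p (z i).1 (z i).2 := by
      refine Finset.prod_subset (Finset.range_mono hm) fun i _ hi => ?_
      have hin : n ≤ i := by simpa using hi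
      have : act s₀ s₁ z i = z i := by
        change ((z (s₀.1 i)).1, (z (s₁.1 i)).2) = z i
        rw [h₀ i hin, h₁ i hin]
      rw [this, div_self (hpos z i).ne']
    rw [hext, ← Finset.prod_mul_distrib]
    exact Finset.prod_congr rfl fun i _ => (div_mul_cancel₀ _ (hpos z i).ne').symm
  unfold jac
  rw [key]
  exact Measure.rnDeriv_withDensity _ hmeas

end WreathRep

namespace WreathRep

/-! ### Two facts on Hilbert spaces and commutants -/

open scoped InnerProductSpace in
/-- A closed subspace that contains `v + e j` for a bounded orthogonal sequence `e` contains
`v`. -/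
theorem mem_of_add_orthogonal {E : Type*} [NormedAddCommGroup E] [InnerProductSpace ℂ E]
    {K : Submodule ℂ E} (hK : IsClosed (K : Set E)) {v : E} {e : ℕ → E} {C : ℝ}
    (hC : ∀ j, ‖e j‖ ≤ C) (ho : ∀ i j, i ≠ j → ⟪e i, e j⟫_ℂ = 0) (hv : ∀ j, v + e j ∈ K) :
    v ∈ K := by
  -- Pythagoras: the sum of `n` terms has norm at most `√n * C`, which the factor `1/n` of an
  -- average beats.
  have hsum (n : ℕ) : ‖∑ j ∈ Finset.range n, e j‖ ^ 2 = ∑ j ∈ Finset.range n, ‖e j‖ ^ 2 := by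
    have h : ⟪∑ j ∈ Finset.range n, e j, ∑ j ∈ Finset.range n, e j⟫_ℂ
        = ∑ j ∈ Finset.range n, ⟪e j, e j⟫_ℂ := by
      rw [sum_inner]
      refine Finset.sum_congr rfl fun i hi => ?_
      rw [inner_sum, Finset.sum_eq_single i (fun j _ hj => ho i j hj.symm) fun h => absurd hi h]
    simp only [inner_self_eq_norm_sq_to_K] at h
    exact_mod_cast h
  have hbound (n : ℕ) : ‖∑ j ∈ Finset.range n, e j‖ ≤ Real.sqrt n * C := by
    have hC0 : 0 ≤ C := (norm_nonneg _).trans (hC 0)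
    refine (sq_le_sq₀ (norm_nonneg _) (by positivity)).mp ?_
    rw [hsum, mul_pow, Real.sq_sqrt n.cast_nonneg]
    calc ∑ j ∈ Finset.range n, ‖e j‖ ^ 2 ≤ ∑ _j ∈ Finset.range n, C ^ 2 :=
          Finset.sum_le_sum fun j _ => pow_le_pow_left₀ (norm_nonneg _) (hC j) 2
      _ = n * C ^ 2 := by simp
  -- Cesàro means lie in `K` and converge to `v` in norm, so norm closedness is enough.
  let a : ℕ → E := fun n => ((n + 1 : ℕ) : ℂ)⁻¹ • ∑ j ∈ Finset.range (n + 1), (v + e j)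
  have ha (n : ℕ) : a n ∈ K := K.smul_mem _ (K.sum_mem fun j _ => hv j)
  have hsub (n : ℕ) : a n - v = ((n + 1 : ℕ) : ℂ)⁻¹ • ∑ j ∈ Finset.range (n + 1), e j := by
    have h0 : ((n + 1 : ℕ) : ℂ) ≠ 0 := by exact_mod_cast n.succ_ne_zero
    simp only [a]
    rw [Finset.sum_add_distrib, smul_add, Finset.sum_const, Finset.card_range,
      ← Nat.cast_smul_eq_nsmul ℂ, smul_smul, inv_mul_cancel₀ h0, one_smul, add_sub_cancel_left]
  refine hK.mem_of_tendsto (f := a) (b := Filter.atTop) ?_ (Filter.Eventually.of_forall ha)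
  rw [tendsto_iff_norm_sub_tendsto_zero]
  have hlim : Filter.Tendsto (fun n : ℕ => C * (Real.sqrt (n + 1 : ℕ))⁻¹) Filter.atTop
      (nhds 0) := by
    rw [← mul_zero C]
    exact ((Real.tendsto_sqrt_atTop.comp (tendsto_natCast_atTop_atTop.comp
      (Filter.tendsto_add_atTop_nat 1))).inv_tendsto_atTop).const_mul C
  refine squeeze_zero (fun _ => norm_nonneg _) (fun n => ?_) hlim
  rw [hsub, norm_smul, norm_inv, Complex.norm_natCast, inv_mul_le_iff₀ (by positivity)]
  refine (hbound (n + 1)).trans_eq ?_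
  rw [mul_comm C, ← mul_assoc, ← div_eq_mul_inv, Real.div_sqrt]

section Bicommutant

variable {K L E : Type*} [Group K] [Group L] [NormedAddCommGroup E] [InnerProductSpace ℂ E]
  [CompleteSpace E]

/-- The closed linear span of `π(K)'' ξ`. -/
def cyclicSpace (π : K →* unitary (E →L[ℂ] E)) (ξ : E) : Submodule ℂ E :=
  (Submodule.span ℂ ((fun a => a ξ) '' bicommutant π)).topologicalClosure

theorem self_mem_cyclicSpace (π : K →* unitary (E →L[ℂ] E)) (ξ : E) : ξ ∈ cyclicSpace π ξ :=
  Submodule.le_topologicalClosure _ (Submodule.subset_span ⟨1, Set.one_mem_centralizer, rfl⟩)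

/-- The bicommutant contains `π g` and is closed under products; continuity of `π g` handles the
closure. -/
theorem apply_mem_cyclicSpace (π : K →* unitary (E →L[ℂ] E)) (ξ : E) (g : K) {v : E}
    (hv : v ∈ cyclicSpace π ξ) : (π g : E →L[ℂ] E) v ∈ cyclicSpace π ξ := by
  have hle : cyclicSpace π ξ ≤ (cyclicSpace π ξ).comap (π g : E →L[ℂ] E).toLinearMap := by
    refine Submodule.topologicalClosure_minimal _ (Submodule.span_le.mpr ?_) ?_
    · rintro _ ⟨a, ha, rfl⟩
      refine Submodule.le_topologicalClosure _ (Submodule.subset_span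
        ⟨(π g : E →L[ℂ] E) * a, Set.mul_mem_centralizer ?_ ha, rfl⟩)
      exact Set.subset_centralizer_centralizer ⟨g, rfl⟩
    · exact (Submodule.isClosed_topologicalClosure _).preimage (π g : E →L[ℂ] E).continuous
  exact hle hv

/-- A cyclic vector for `ρ(L)''` is separating for `π(K)''` if `π` and `ρ` commute. -/
theorem isSeparatingVector_of_commute (π : K →* unitary (E →L[ℂ] E))
    (ρ : L →* unitary (E →L[ℂ] E)) (hcomm : ∀ g h, π g * ρ h = ρ h * π g) {ξ : E}
    (hξ : IsCyclicVector (bicommutant ρ) ξ) : IsSeparatingVector (bicommutant π) ξ := by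
  intro a ha haξ
  have hρ : (Set.range fun h => (ρ h : E →L[ℂ] E)) ⊆
      (Set.range fun g => (π g : E →L[ℂ] E)).centralizer := by
    rintro _ ⟨h, rfl⟩ _ ⟨g, rfl⟩
    exact congrArg Subtype.val (hcomm g h)
  -- Taking commutants reverses inclusions: `ρ(L) ⊆ π(K)'` gives `π(K)'' ⊆ ρ(L)'`.
  have ha' : a ∈ (Set.range fun h => (ρ h : E →L[ℂ] E)).centralizer :=
    Set.centralizer_subset hρ ha
  have hle : (⊤ : Submodule ℂ E) ≤ LinearMap.ker a.toLinearMap := by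
    rw [← hξ]
    refine Submodule.topologicalClosure_minimal _ (Submodule.span_le.mpr ?_) ?_
    · rintro _ ⟨b, hb, rfl⟩
      have h : b (a ξ) = a (b ξ) := DFunLike.congr_fun (hb a ha').symm ξ
      have h' : a (b ξ) = 0 := by rw [← h, haξ, map_zero]
      exact h'
    · exact isClosed_singleton.preimage a.continuous
  ext v
  exact hle (Submodule.mem_top (x := v))

end Bicommutant

end WreathRep

namespace WreathRep

/-! ### Closed subspaces of `L²(X, μ)` containing all cylinder functions -/

variable {P : Weights} {K : Submodule ℂ (H P)}

/-- The function `f` represents an element of `K`. -/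
def Represents (K : Submodule ℂ (H P)) (f : X → ℂ) : Prop := ∃ g ∈ K, g =ᵐ[mu P] f

theorem Represents.add {f g : X → ℂ} (hf : Represents K f) (hg : Represents K g) :
    Represents K fun x => f x + g x := by
  obtain ⟨f', hf', hf⟩ := hf
  obtain ⟨g', hg', hg⟩ := hg
  exact ⟨f' + g', K.add_mem hf' hg', (Lp.coeFn_add f' g').trans (hf.add hg)⟩

theorem Represents.const_mul {f : X → ℂ} (a : ℂ) (hf : Represents K f) :
    Represents K fun x => a * f x := by
  obtain ⟨f', hf', hf⟩ := hf
  refine ⟨a • f', K.smul_mem a hf', ?_⟩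
  filter_upwards [Lp.coeFn_smul a f', hf] with x h1 h2
  rw [h1, Pi.smul_apply, h2, smul_eq_mul]

theorem Represents.toLp_mem {f : X → ℂ} (hf : Represents K f) (h : MemLp f 2 (mu P)) :
    h.toLp f ∈ K := by
  obtain ⟨f', hf', hf⟩ := hf
  rwa [show h.toLp f = f' from Lp.ext (h.coeFn_toLp.trans hf.symm)]

/-- The indicator function of a cylinder. -/
noncomputable def cylFun (n : ℕ) (z : X) : X → ℂ := (cyl n z).indicator 1

theorem measurable_cylFun (n : ℕ) (z : X) : Measurable (cylFun n z) :=
  measurable_one.indicator (measurableSet_cyl n z)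

theorem norm_cylFun_le (n : ℕ) (z x : X) : ‖cylFun n z x‖ ≤ 1 := by
  unfold cylFun
  by_cases h : x ∈ cyl n z <;> simp [h]

/-- A closed subspace that contains all cylinder functions is everything. -/
theorem eq_top_of_cylFun (hK : IsClosed (K : Set (H P))) (h : ∀ n z, Represents K (cylFun n z)) :
    K = ⊤ := by
  have : CompleteSpace K := hK.completeSpace_coe
  rw [← Submodule.orthogonal_eq_bot_iff, Submodule.eq_bot_iff]
  intro v hv
  have hint : Integrable v (mu P) := (Lp.memLp v).integrable (by norm_num)
  refine Lp.ext ((ae_eq_zero_of_forall_cyl hint fun n z => ?_).trans (Lp.coeFn_zero _ _ _).symm)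
  obtain ⟨g, hg, hgc⟩ := h n z
  have h0 := (Submodule.mem_orthogonal K v).mp hv g hg
  rw [L2.inner_def] at h0
  rw [← h0, ← integral_indicator (measurableSet_cyl n z)]
  refine integral_congr_ae ?_
  filter_upwards [hgc] with x hx
  rw [hx, cylFun]
  by_cases hm : x ∈ cyl n z <;> simp [hm]

/-! ### Orthogonality of centred functions of different coordinates -/

/-- Coordinate `N` is independent of those in `F`, so the integral factors and the centred factor
vanishes. -/
theorem integral_mul_coord_eq_zero (P : Weights) {F : Finset ℕ} {N : ℕ} (hN : N ∉ F)
    (φ : ({i // i ∈ F} → ZMod 2 × ZMod 2) → ℂ) {ψ : ZMod 2 × ZMod 2 → ℂ}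
    (hψ : ∫ y, ψ y ∂nu P = 0) : ∫ x, φ (fun i => x i) * ψ (x N) ∂mu P = 0 := by
  have hind : ProbabilityTheory.iIndepFun (fun (i : ℕ) (x : X) => x i) (mu P) :=
    ProbabilityTheory.iIndepFun_infinitePi (X := fun _ => id) fun _ => measurable_id
  have h := hind.indepFun_finset F {N} (Finset.disjoint_singleton_right.mpr hN)
    fun i => measurable_pi_apply i
  have hφ : Measurable φ := measurable_of_countable φ
  have hψm : Measurable ψ := measurable_of_countable ψ
  have hψ' : Measurable fun y : {i // i ∈ ({N} : Finset ℕ)} → ZMod 2 × ZMod 2 =>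
    ψ (y ⟨N, Finset.mem_singleton_self N⟩) := hψm.comp (measurable_pi_apply _)
  have h2 := h.comp hφ hψ'
  have h3 : ∫ x, ψ (x N) ∂mu P = 0 := by
    rw [← hψ]
    have hmp := measurePreserving_eval_infinitePi (fun _ : ℕ => nu P) N
    rw [← hmp.map_eq, integral_map hmp.measurable.aemeasurable hψm.aestronglyMeasurable]
    rfl
  have h4 := h2.integral_fun_mul_eq_mul_integral
    (hφ.comp (measurable_pi_lambda _ fun i => measurable_pi_apply _)).aestronglyMeasurable
    (hψ'.comp (measurable_pi_lambda _ fun i => measurable_pi_apply _)).aestronglyMeasurable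
  simp only [Function.comp_def] at h4
  rw [h4, h3, mul_zero]

theorem norm_le_sum {A : Type*} [Fintype A] (u : A → ℂ) (a : A) : ‖u a‖ ≤ ∑ b, ‖u b‖ :=
  Finset.single_le_sum (f := fun b => ‖u b‖) (fun _ _ => norm_nonneg _) (Finset.mem_univ a)

/-- If all functions `1_C(x) u(x_k) w(x_N)`, `N > k`, with `C` a cylinder of length `k`,
belong to a closed subspace, then so does their weak limit. -/
theorem represents_of_forall_gt (hK : IsClosed (K : Set (H P))) {k : ℕ} {z : X}
    {u w : ZMod 2 × ZMod 2 → ℂ}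
    (h : ∀ N > k, Represents K fun x => cylFun k z x * u (x k) * w (x N)) :
    Represents K fun x => (∫ y, w y ∂nu P) * (cylFun k z x * u (x k)) := by
  set m : ℂ := ∫ y, w y ∂nu P
  let ψ : ZMod 2 × ZMod 2 → ℂ := fun y => w y - m
  have hψ : ∫ y, ψ y ∂nu P = 0 := by
    simp only [ψ]
    rw [integral_sub Integrable.of_finite (integrable_const _)]
    simp [m]
  let v : X → ℂ := fun x => m * (cylFun k z x * u (x k))
  let e : ℕ → X → ℂ := fun N x => cylFun k z x * u (x k) * ψ (x N)
  have hu : Measurable fun x : X => u (x k) :=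
    (measurable_of_countable u).comp (measurable_pi_apply k)
  have hvm : Measurable v := ((measurable_cylFun k z).mul hu).const_mul m
  have hem (N : ℕ) : Measurable (e N) := ((measurable_cylFun k z).mul hu).mul
    ((measurable_of_countable ψ).comp (measurable_pi_apply N))
  have hcu (x : X) : ‖cylFun k z x * u (x k)‖ ≤ ∑ b, ‖u b‖ := by
    rw [norm_mul]
    refine (mul_le_of_le_one_left (norm_nonneg _) (norm_cylFun_le k z x)).trans (norm_le_sum u _)
  have heb (N : ℕ) (x : X) : ‖e N x‖ ≤ (∑ b, ‖u b‖) * ∑ b, ‖ψ b‖ := by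
    rw [norm_mul]
    exact mul_le_mul (hcu x) (norm_le_sum ψ _) (norm_nonneg _)
      (Finset.sum_nonneg fun _ _ => norm_nonneg _)
  have hv : MemLp v 2 (mu P) := MemLp.of_bound hvm.aestronglyMeasurable (‖m‖ * ∑ b, ‖u b‖)
    (Filter.Eventually.of_forall fun x => by
      rw [norm_mul]; exact mul_le_mul_of_nonneg_left (hcu x) (norm_nonneg _))
  have he (N : ℕ) : MemLp (e N) 2 (mu P) := MemLp.of_bound (hem N).aestronglyMeasurable _
    (Filter.Eventually.of_forall (heb N))
  refine ⟨hv.toLp v, mem_of_add_orthogonal hK (e := fun j => (he (k + 1 + j)).toLp _)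
    (fun j => Lp.norm_le_of_ae_bound (C := (∑ b, ‖u b‖) * ∑ b, ‖ψ b‖) (by positivity) ?_) ?_ ?_,
    hv.coeFn_toLp⟩
  · filter_upwards [(he (k + 1 + j)).coeFn_toLp] with x hx
    rw [hx]; exact heb _ x
  · intro i j hij
    -- `F` holds every coordinate that the inner product reads, except the one in the centred factor
    -- `ψ (x (k + 1 + j))`.
    obtain ⟨F, hFdef⟩ : ∃ F, F = insert (k + 1 + i) (Finset.range (k + 1)) := ⟨_, rfl⟩
    have hne : k + 1 + j ∉ F := by
      simp [hFdef]; omega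
    have hF : ∀ l < k + 1, l ∈ F := fun l hl => hFdef ▸
      Finset.mem_insert_of_mem (Finset.mem_range.mpr hl)
    -- Filling with `0` outside `F` is harmless, since only places in `F` are read.
    let ext : ({l // l ∈ F} → ZMod 2 × ZMod 2) → X := fun y l => if hl : l ∈ F then y ⟨l, hl⟩ else 0
    have hext (x : X) (l : ℕ) (hl : l ∈ F) : ext (fun i => x i) l = x l := by simp [ext, hl]
    have hcyl (x : X) : cylFun k z (ext fun i => x i) = cylFun k z x := by
      unfold cylFun
      refine Set.indicator_eq_indicator ?_ rfl
      refine forall₂_congr fun l hl => ?_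
      rw [hext x l (hF l (by omega))]
    rw [L2.inner_def, ← integral_mul_coord_eq_zero P hne (fun y =>
      (starRingEnd ℂ) (e (k + 1 + i) (ext y)) * (cylFun k z (ext y) * u (ext y k))) hψ]
    refine integral_congr_ae ?_
    filter_upwards [(he (k + 1 + i)).coeFn_toLp, (he (k + 1 + j)).coeFn_toLp] with x h1 h2
    rw [h1, h2]
    simp only [e, hcyl]
    rw [hext x k (hF k (by omega)), hext x (k + 1 + i) (hFdef ▸ Finset.mem_insert_self _ _)]
    simp only [RCLike.inner_apply]
    ring
  · intro j
    have hsum : Represents K (v + e (k + 1 + j)) := by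
      have h' := h (k + 1 + j) (by omega)
      have heq : (v + e (k + 1 + j)) =
          fun x => cylFun k z x * u (x k) * w (x (k + 1 + j)) := by
        funext x
        simp only [v, e, ψ, Pi.add_apply]
        ring
      rwa [heq]
    rw [← MemLp.toLp_add hv (he _)]
    exact hsum.toLp_mem _

/-! ### The criterion for totality -/

/-- Multiplication by `1_{c = a}`, expressed by the character `(-1) ^ c`. -/
theorem half_one_add_sgn (a b : ZMod 2) :
    (1 + sgn a * sgn b) / 2 = if b = a then 1 else 0 := by
  rw [← sgn_add]
  have h : ∀ a b : ZMod 2, b = a ↔ a + b = 0 := by decide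
  have h2 : ∀ t : ZMod 2, t = 0 ∨ t = 1 := by decide
  simp only [h a b]
  rcases h2 (a + b) with h | h
  · simp [h, sgn]
  · simp [h, sgn, ZMod.val_one]

/-- Let `c`, `d` be coordinates on `ℤ₂ × ℤ₂` and `q` the weights in these coordinates. A closed
subspace that contains `1`, is invariant under the characters `(-1) ^ c(x_k)` and contains the
transforms of cylinder functions under transpositions of the `c`-coordinates is everything. -/
theorem eq_top_of_invariant (hK : IsClosed (K : Set (H P))) {c d : ZMod 2 × ZMod 2 → ZMod 2}
    (hcd : ∀ y y', c y = c y' → d y = d y' → y = y') (hc : Function.Surjective c)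
    {q : ZMod 2 → ZMod 2 → ℝ} (hq : ∀ a b, 0 < q a b) (hdet : q 0 0 * q 1 1 ≠ q 0 1 * q 1 0)
    (hone : Represents K fun _ => 1)
    (hsgn : ∀ k f, Represents K f → Represents K fun x => sgn (c (x k)) * f x)
    (hswap : ∀ k N z, k < N → Represents K (cylFun k z) → Represents K fun x =>
      ((Real.sqrt (q (c (x N)) (d (x k)) / q (c (x k)) (d (x k)) *
        (q (c (x k)) (d (x N)) / q (c (x N)) (d (x N)))) : ℝ) : ℂ) * cylFun k z x) : K = ⊤ := by
  have hind (k : ℕ) (a : ZMod 2) (f : X → ℂ) (hf : Represents K f) :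
      Represents K fun x => (if c (x k) = a then 1 else 0) * f x := by
    have := (hf.add ((hsgn k f hf).const_mul (sgn a))).const_mul (1 / 2)
    convert this using 2 with x
    rw [← half_one_add_sgn]
    ring
  have h2 : ∀ t : ZMod 2, t = 0 ∨ t = 1 := by decide
  refine eq_top_of_cylFun hK fun n z => ?_
  induction n with
  | zero =>
    convert hone using 2 with x
    simp [cylFun, cyl]
  | succ k ih =>
    let a := c (z k)
    -- Where `c(x_k) = a` and `c(x_N) = a + 1`, the square root of the Jacobian of the swap is `Q (d
    -- (x k)) * R (d (x N))`.
    let Q : ZMod 2 → ℝ := fun b => Real.sqrt (q (a + 1) b / q a b)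
    let R : ZMod 2 → ℝ := fun b => Real.sqrt (q a b / q (a + 1) b)
    let u : ZMod 2 × ZMod 2 → ℂ := fun y => if c y = a then (Q (d y) : ℂ) else 0
    let w : ZMod 2 × ZMod 2 → ℝ := fun y => if c y = a + 1 then R (d y) else 0
    have hw0 (y) : 0 ≤ w y := by
      simp only [w]; split_ifs <;> simp [R]
    -- `w` is nonnegative, and positive at some point because `c` attains `a + 1`; all points have
    -- positive mass.
    have hm : (∫ y, (w y : ℂ) ∂nu P) ≠ 0 := by
      rw [integral_complex_ofReal, Complex.ofReal_ne_zero, integral_fintype Integrable.of_finite]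
      obtain ⟨y, hy⟩ := hc (a + 1)
      refine (Finset.sum_pos' (fun y _ => smul_nonneg measureReal_nonneg (hw0 y))
        ⟨y, Finset.mem_univ y, ?_⟩).ne'
      refine smul_pos ?_ ?_
      · rw [Measure.real, nu_singleton, ENNReal.toReal_ofReal (P.pos _ _).le]
        exact P.pos _ _
      · simp only [w, hy, if_true, R]
        exact Real.sqrt_pos.mpr (div_pos (hq _ _) (hq _ _))
    have hu : Represents K fun x => cylFun k z x * u (x k) := by
      have hN : ∀ N > k, Represents K fun x => cylFun k z x * u (x k) * (w (x N) : ℂ) := by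
        intro N hN
        convert hind k a _ (hind N (a + 1) _ (hswap k N z hN ih)) using 2 with x
        by_cases h1 : c (x k) = a
        · by_cases h2 : c (x N) = a + 1
          · simp only [u, w, h1, h2, if_true, Q, R]
            rw [Real.sqrt_mul (div_pos (hq _ _) (hq _ _)).le]
            push_cast
            ring
          · simp [u, w, h2]
        · simp [u, h1]
      have := (represents_of_forall_gt hK (w := fun y => (w y : ℂ)) hN).const_mul
        (∫ y, (w y : ℂ) ∂nu P)⁻¹
      convert this using 2 with x
      rw [inv_mul_cancel_left₀ hm]
    let b := d (z k)
    have hb2 : ∀ t : ZMod 2, t = b ∨ t = b + 1 := by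
      have : ∀ b t : ZMod 2, t = b ∨ t = b + 1 := by decide
      exact this b
    -- Equality of the two ratios would be proportionality of the rows of `q`, whichever values `a`
    -- and `b` take.
    have hQ : Q b ≠ Q (b + 1) := by
      intro h
      simp only [Q] at h
      rw [Real.sqrt_inj (div_pos (hq _ _) (hq _ _)).le (div_pos (hq _ _) (hq _ _)).le,
        div_eq_div_iff (hq _ _).ne' (hq _ _).ne'] at h
      have h11 : (1 + 1 : ZMod 2) = 0 := by decide
      apply hdet
      rcases h2 a with ha | ha <;> rcases h2 b with hb | hb <;>
        rw [ha, hb] at h <;> simp only [h11, zero_add] at h <;> linarith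
    have hQ' : ((Q b : ℂ) - Q (b + 1)) ≠ 0 := by
      rw [sub_ne_zero]; exact_mod_cast hQ
    -- Interpolation: `(Q (d y) - Q (b + 1)) / (Q b - Q (b + 1))` is the indicator of `d y = b`.
    convert ((hu.add ((hind k a _ ih).const_mul (-(Q (b + 1) : ℂ)))).const_mul
      ((Q b : ℂ) - Q (b + 1))⁻¹) using 2 with x
    have hsucc : x ∈ cyl (k + 1) z ↔ x ∈ cyl k z ∧ x k = z k := by
      refine ⟨fun h => ⟨fun i hi => h i (by omega), h k (by omega)⟩, fun h i hi => ?_⟩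
      rcases (Nat.lt_succ_iff_lt_or_eq.mp hi) with hi | rfl
      exacts [h.1 i hi, h.2]
    by_cases hx : x ∈ cyl k z
    · by_cases h1 : c (x k) = a
      · rcases hb2 (d (x k)) with h3 | h3
        · have hz : x k = z k := hcd _ _ h1 h3
          simp only [cylFun, hsucc, hx, hz, and_self, Set.indicator_of_mem, u, Pi.one_apply]
          simp only [a, b] at hQ' ⊢
          field_simp
          simp
          ring
        · have hz : x k ≠ z k := fun h => by
            have : b = b + 1 := by rw [← h3, h]
            simp at this
          simp [cylFun, hsucc, hx, hz, u, h1, h3]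
      · have hz : x k ≠ z k := fun h => h1 (by rw [h])
        simp [cylFun, hsucc, hx, hz, u, h1]
    · simp [cylFun, hsucc, hx]

end WreathRep

namespace WreathRep

variable {P : Weights} {K : Submodule ℂ (H P)}

/-! ### The operators of the representation -/

/-- The transposition of `k` and `N`. -/
def finSwap (k N : ℕ) : FinPerm :=
  ⟨Equiv.swap k N, ((Set.finite_singleton N).insert k).subset fun i hi => by
    by_contra h
    simp only [Set.mem_insert_iff, Set.mem_singleton_iff, not_or] at h
    exact hi (Equiv.swap_apply_of_ne_of_ne h.1 h.2)⟩

theorem finSwap_of_lt {k N n : ℕ} (hk : k < n) (hN : N < n) : ∀ i ≥ n, (finSwap k N).1 i = i :=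
  fun _ hi => Equiv.swap_apply_of_ne_of_ne (by omega) (by omega)

/-- The sequence with nontrivial entry at `k` only. -/
def finSingle (k : ℕ) : FinSeq Z2 :=
  ⟨Pi.mulSingle k (Multiplicative.ofAdd 1), (Set.finite_singleton k).subset fun i hi => by
    by_contra h
    exact hi (Pi.mulSingle_eq_of_ne h _)⟩

theorem finSingle_mul (k i : ℕ) (a : ZMod 2) :
    ((finSingle k).1 i).toAdd * a = if i = k then a else 0 := by
  by_cases h : i = k
  · subst h; simp [finSingle]
  · simp [finSingle, h]

theorem gammaSign_single_one (k : ℕ) (x : X) : gammaSign (finSingle k) 1 x = sgn (x k).1 := by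
  unfold gammaSign
  rw [finsum_eq_single _ k fun i hi => by simp [finSingle_mul, hi]]
  simp [finSingle_mul]

theorem gammaSign_one_single (k : ℕ) (x : X) : gammaSign 1 (finSingle k) x = sgn (x k).2 := by
  unfold gammaSign
  rw [finsum_eq_single _ k fun i hi => by simp [finSingle_mul, hi]]
  simp [finSingle_mul]

theorem gammaSign_one_one (x : X) : gammaSign 1 1 x = 1 := by
  simp [gammaSign, sgn]

/-- Quasi-invariance lets a representative be changed on a null set before composing with the
action, so the operator can be computed on explicit functions. -/
theorem Represents.piMu {g : G × G} (hg : ∀ v ∈ K, (piMu P g : H P →L[ℂ] H P) v ∈ K)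
    {f : X → ℂ} (hf : Represents K f) {n : ℕ} (h₀ : ∀ i ≥ n, g.1.right.1 i = i)
    (h₁ : ∀ i ≥ n, g.2.right.1 i = i) :
    Represents K fun x => gammaSign g.1.left g.2.left x *
      ((Real.sqrt (∏ i ∈ Finset.range n, P.p (act g.1.right g.2.right x i).1
        (act g.1.right g.2.right x i).2 / P.p (x i).1 (x i).2) : ℝ) : ℂ) *
      f (act g.1.right g.2.right x) := by
  obtain ⟨f', hf', hf⟩ := hf
  refine ⟨_, hg f' hf', ?_⟩
  filter_upwards [piMu_apply_ae P g f', jac_act P h₀ h₁,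
    (act_qmp P g.1.right g.2.right).ae hf] with x h1 h2 h3
  unfold jac at h2
  rw [h1, h2, h3, ENNReal.toReal_ofReal]
  exact Finset.prod_nonneg fun i _ => (div_pos (P.pos _ _) (P.pos _ _)).le

theorem Represents.sgn_mul {γ₀ γ₁ : FinSeq Z2}
    (hg : ∀ v ∈ K, (WreathRep.piMu P (⟨γ₀, 1⟩, ⟨γ₁, 1⟩) : H P →L[ℂ] H P) v ∈ K) {f : X → ℂ}
    (hf : Represents K f) : Represents K fun x => gammaSign γ₀ γ₁ x * f x := by
  -- The permutations are trivial, so `n = 0` makes the Jacobian an empty product.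
  have := hf.piMu hg (n := 0) (fun _ _ => rfl) (fun _ _ => rfl)
  have hact (x : X) : act 1 1 x = x := rfl
  simpa [hact] using this

/-- Only the factors at `k` and `N` of the Jacobian differ from `1`, and a cylinder of length `k <
N` sees neither place. The coordinates `c`, `d` are kept abstract so that both copies of `G` are
covered. -/
theorem Represents.swap {c d : ZMod 2 × ZMod 2 → ZMod 2} {q : ZMod 2 → ZMod 2 → ℝ}
    (hq : ∀ y, P.p y.1 y.2 = q (c y) (d y)) {s₀ s₁ : FinPerm} {k N : ℕ} (hkN : k < N)
    (hs₀ : ∀ i ≥ N + 1, s₀.1 i = i) (hs₁ : ∀ i ≥ N + 1, s₁.1 i = i)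
    (hc : ∀ x i, c (act s₀ s₁ x i) = c (x (Equiv.swap k N i)))
    (hd : ∀ x i, d (act s₀ s₁ x i) = d (x i))
    (hcd : ∀ y y', c y = c y' → d y = d y' → y = y')
    (hg : ∀ v ∈ K, (WreathRep.piMu P (⟨1, s₀⟩, ⟨1, s₁⟩) : H P →L[ℂ] H P) v ∈ K) {z : X}
    (hz : Represents K (cylFun k z)) : Represents K fun x =>
      ((Real.sqrt (q (c (x N)) (d (x k)) / q (c (x k)) (d (x k)) *
        (q (c (x k)) (d (x N)) / q (c (x N)) (d (x N)))) : ℝ) : ℂ) * cylFun k z x := by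
  have hfix (x : X) (i : ℕ) (hik : i ≠ k) (hiN : i ≠ N) : act s₀ s₁ x i = x i :=
    hcd _ _ (by rw [hc, Equiv.swap_apply_of_ne_of_ne hik hiN]) (hd x i)
  have hpos (y : ZMod 2 × ZMod 2) : q (c y) (d y) ≠ 0 := by
    rw [← hq]; exact (P.pos _ _).ne'
  convert hz.piMu hg hs₀ hs₁ using 2 with x
  rw [gammaSign_one_one, one_mul]
  congr 1
  · simp only [hq, hc, hd]
    rw [Finset.prod_eq_mul k N hkN.ne (fun i _ hi => by
        rw [Equiv.swap_apply_of_ne_of_ne hi.1 hi.2, div_self (hpos _)])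
      (fun h => absurd (Finset.mem_range.mpr (by omega)) h)
      (fun h => absurd (Finset.mem_range.mpr (by omega)) h),
      Equiv.swap_apply_left, Equiv.swap_apply_right]
  · unfold cylFun
    refine Set.indicator_eq_indicator ?_ rfl
    refine forall₂_congr fun i hi => ?_
    rw [hfix x i (by omega) (by omega)]

theorem represents_one (h : constOne P ∈ K) : Represents K fun _ => 1 :=
  ⟨_, h, Lp.coeFn_const _ _ _⟩

/-! ### Cyclicity -/

theorem isCyclicVector_piMu0 (P : Weights) (hdet : P.p.det ≠ 0) :
    IsCyclicVector (bicommutant (piMu0 P)) (constOne P) := by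
  have hinv (g : G) : ∀ v ∈ cyclicSpace (piMu0 P) (constOne P),
      (piMu P (g, 1) : H P →L[ℂ] H P) v ∈ cyclicSpace (piMu0 P) (constOne P) :=
    fun v hv => apply_mem_cyclicSpace (piMu0 P) _ g hv
  change cyclicSpace (piMu0 P) (constOne P) = ⊤
  refine eq_top_of_invariant (c := Prod.fst) (d := Prod.snd) (q := P.p)
    (Submodule.isClosed_topologicalClosure _) (fun _ _ => Prod.ext) Prod.fst_surjective P.pos
    ?_ (represents_one (self_mem_cyclicSpace _ _)) (fun k f hf => ?_) fun k N z hkN hz => ?_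
  · have := (Matrix.det_fin_two P.p).symm.trans_ne hdet
    exact sub_ne_zero.mp this
  · simpa only [gammaSign_single_one] using hf.sgn_mul (hinv ⟨finSingle k, 1⟩)
  · exact hz.swap (c := Prod.fst) (d := Prod.snd) (s₀ := finSwap k N) (s₁ := 1) (fun _ => rfl) hkN
      (finSwap_of_lt (by omega) (by omega)) (fun _ _ => rfl) (fun _ _ => rfl) (fun _ _ => rfl)
      (fun _ _ => Prod.ext) (hinv ⟨1, finSwap k N⟩)

/-- The coordinates exchange roles and the weights are transposed, which preserves the determinant.
-/
theorem isCyclicVector_piMu1 (P : Weights) (hdet : P.p.det ≠ 0) :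
    IsCyclicVector (bicommutant (piMu1 P)) (constOne P) := by
  have hinv (g : G) : ∀ v ∈ cyclicSpace (piMu1 P) (constOne P),
      (piMu P (1, g) : H P →L[ℂ] H P) v ∈ cyclicSpace (piMu1 P) (constOne P) :=
    fun v hv => apply_mem_cyclicSpace (piMu1 P) _ g hv
  change cyclicSpace (piMu1 P) (constOne P) = ⊤
  refine eq_top_of_invariant (c := Prod.snd) (d := Prod.fst) (q := fun a b => P.p b a)
    (Submodule.isClosed_topologicalClosure _) (fun _ _ h h' => Prod.ext h' h)
    Prod.snd_surjective (fun a b => P.pos b a)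
    ?_ (represents_one (self_mem_cyclicSpace _ _)) (fun k f hf => ?_) fun k N z hkN hz => ?_
  · have := (Matrix.det_fin_two P.p).symm.trans_ne hdet
    rw [mul_comm (P.p 1 0)]
    exact sub_ne_zero.mp this
  · simpa only [gammaSign_one_single] using hf.sgn_mul (hinv ⟨finSingle k, 1⟩)
  · exact hz.swap (c := Prod.snd) (d := Prod.fst) (q := fun a b => P.p b a) (s₀ := 1)
      (s₁ := finSwap k N) (fun _ => rfl) hkN (fun _ _ => rfl)
      (finSwap_of_lt (by omega) (by omega)) (fun _ _ => rfl) (fun _ _ => rfl)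
      (fun _ _ h h' => Prod.ext h' h) (hinv ⟨1, finSwap k N⟩)

theorem commute_piMu0_piMu1 (P : Weights) (g h : G) :
    piMu0 P g * piMu1 P h = piMu1 P h * piMu0 P g := by
  simp only [piMu0, piMu1, MonoidHom.comp_apply, ← map_mul]
  congr 1
  simp

end WreathRep

theorem theorem3 (P : WreathRep.Weights) (hdet : P.p.det ≠ 0) :
    (WreathRep.IsCyclicVector (WreathRep.bicommutant (WreathRep.piMu0 P)) (WreathRep.constOne P) ∧
      WreathRep.IsSeparatingVector (WreathRep.bicommutant (WreathRep.piMu0 P))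
        (WreathRep.constOne P)) ∧
    (WreathRep.IsCyclicVector (WreathRep.bicommutant (WreathRep.piMu1 P)) (WreathRep.constOne P) ∧
      WreathRep.IsSeparatingVector (WreathRep.bicommutant (WreathRep.piMu1 P))
        (WreathRep.constOne P)) := by
  have h0 := WreathRep.isCyclicVector_piMu0 P hdet
  have h1 := WreathRep.isCyclicVector_piMu1 P hdet
  exact ⟨⟨h0, WreathRep.isSeparatingVector_of_commute _ _ (WreathRep.commute_piMu0_piMu1 P) h1⟩,
    h1, WreathRep.isSeparatingVector_of_commute _ _
      (fun g h => (WreathRep.commute_piMu0_piMu1 P h g).symm) h0⟩
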